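/- Let $L$ be the frame of open subspaces of a locale $X$, let $\mathrm{Sh}(X)$ be the topos of sheaves of sets on $X$, and let $\mathcal{L}$ be a corresponding localic topos, i.e. a category equivalent to $\mathrm{Sh}(X)$. An object $F$ of $\mathcal{L}$ is called \emph{cardinal finite} if the statement "there is a natural number $n$ with $F \simeq \{1,\dots,n\}$" holds in the internal logic of $\mathcal{L}$; that is, if there is a family $(V_n)_{n\in\mathbb{N}}$ of objects covering the terminal object such that, for each $n$, the pullback $V_n \times F \to V_n$ is isomorphic in the slice $\mathcal{L}_{/V_n}$ to the coproduct of $n$ copies of the terminal object. The topos $\mathcal{L}$ is \emph{generated by cardinal finite objects} if it has a (small) generating set consisting of cardinal finite objects. Then $\mathcal{L}$ is generated by cardinal finite objects if and only if $X$ has a basis of complemented open subspaces, i.e. there is a set $B$ of complemented elements of $L$ such that every element of $L$ is a supremum of elements of $B$. -/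

import Mathlib

open CategoryTheory CategoryTheory.Limits

universe u v w

/-- The canonical Grothendieck topology on the frame `L` of open subspaces of a locale, seen as a
category through its order: a sieve on `U` is covering when the opens that belong to it have
supremum `U`. -/
def frameTopology (L : Type u) [Order.Frame L] : GrothendieckTopology L where
  sieves U := {S | sSup {V : L | ∃ f : V ⟶ U, S f} = U}
  top_mem' U := le_antisymm (sSup_le fun _ ⟨f, _⟩ => leOfHom f) (le_sSup ⟨𝟙 U, trivial⟩)
  pullback_stable' U W S f hS := by
    refine le_antisymm (sSup_le fun _ ⟨g, _⟩ => leOfHom g) ?_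
    have hS' : sSup {V : L | ∃ f : V ⟶ U, S f} = U := hS
    calc W = W ⊓ sSup {V : L | ∃ f : V ⟶ U, S f} := by
            rw [hS']; exact (inf_eq_left.2 (leOfHom f)).symm
      _ ≤ _ := by
            rw [inf_sSup_eq]
            refine iSup₂_le fun V hV => le_sSup ?_
            obtain ⟨g, hg⟩ := hV
            exact ⟨homOfLE inf_le_left, S.downward_closed hg (homOfLE inf_le_right)⟩
  transitive' U S hS R hR := by
    refine le_antisymm (sSup_le fun _ ⟨g, _⟩ => leOfHom g) ?_
    have hS' : sSup {V : L | ∃ f : V ⟶ U, S f} = U := hS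
    calc U = sSup {V : L | ∃ f : V ⟶ U, S f} := hS'.symm
      _ ≤ _ := by
            refine sSup_le fun V hV => ?_
            obtain ⟨g, hg⟩ := hV
            have h : sSup {W : L | ∃ k : W ⟶ V, R.pullback g k} = V := hR hg
            calc V = sSup {W : L | ∃ k : W ⟶ V, R.pullback g k} := h.symm
              _ ≤ _ := by
                refine sSup_le_sSup fun W hW => ?_
                obtain ⟨k, hk⟩ := hW
                exact ⟨k ≫ g, hk⟩

/-- The topos `Sh(L)` of sheaves of sets on the locale whose frame of open subspaces is `L`. -/
abbrev LocaleSheaf (L : Type u) [Order.Frame L] : Type (u + 1) :=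
  Sheaf (frameTopology L) (Type u)

/-- An object `X` of a topos is cardinal finite when the statement "there is a natural number `n`
such that `X ≃ {1, …, n}`" holds in the internal logic, that is, locally: there is a cover
`(V n)` of the terminal object such that, for every `n`, the pullback of `X` to the slice over
`V n` is isomorphic to the coproduct of `n` copies of the terminal object of that slice. (As the
natural number object is the coproduct of `ℕ` copies of the terminal object, a cover on which a
natural number is given amounts to a cover indexed by `ℕ`.) -/
def IsCardinalFinite {E : Type v} [Category.{w} E] [HasFiniteProducts E] [HasFiniteCoproducts E]
    (X : E) : Prop :=
  ∃ V : ℕ → E,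
    (∀ ⦃Y : E⦄ (f g : ⊤_ E ⟶ Y),
      (∀ n, terminal.from (V n) ≫ f = terminal.from (V n) ≫ g) → f = g) ∧
    ∀ n, Nonempty ((Over.star (V n)).obj X ≅ ∐ fun _ : Fin n => Over.mk (𝟙 (V n)))

/-- A topos is generated by cardinal finite objects when it has a generating set (a generating
family indexed by a small set) of cardinal finite objects. -/
def IsGeneratedByCardinalFinite (E : Type v) [Category.{w} E] [HasFiniteProducts E]
    [HasFiniteCoproducts E] : Prop :=
  ∃ (I : Type u) (D : I → E),
    (∀ i, IsCardinalFinite (D i)) ∧ (ObjectProperty.ofObj D).IsSeparating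

/-- `B` is a basis of the locale whose frame of open subspaces is `L`: every open subspace is a
union of members of `B`. -/
def IsLocaleBasis {L : Type u} [Order.Frame L] (B : Set L) : Prop :=
  ∀ U : L, ∃ S ⊆ B, U = sSup S

/-! ### Opens as subterminal sheaves. -/

section opens

variable {L : Type u} [Order.Frame L]

/-! Opens are subterminal objects, and every object maps to its support, the least open receiving a
map from it. If `X` is cardinal finite, its support is complemented by that of `V 0`: the two are
disjoint because `V 0 × X` is initial, and they cover because `X` has a section over each `V n` with
`n ≥ 1` (`IsCardinalFinite.isComplemented_openSupport`). If such objects generate, any map from a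
generator to `U` factors through a complemented open below `U`, so the union of these opens maps
epimorphically to `U`, hence equals it. Conversely, a complemented open has one element over itself
and none over its complement, so it is cardinal finite; and maps out of an open are determined on
any cover by basic opens. -/

instance frameTopology_subcanonical : (frameTopology L).Subcanonical :=
  .of_isSheaf_yoneda_obj _ fun U V S hS x _ => by
    have hS' : sSup {W : L | ∃ f : W ⟶ V, S f} = V := hS
    refine ⟨homOfLE ?_, fun W _ _ => ?_, fun _ _ => ?_⟩
    rotate_left
    · exact Subsingleton.elim (α := (W ⟶ U)) _ _
    · exact Subsingleton.elim (α := (V ⟶ U)) _ _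
    rw [← hS']
    exact sSup_le fun W ⟨f, hf⟩ => leOfHom (x f hf)

/-- The sheaf represented by an open subspace. -/
abbrev openSheaf (U : L) : LocaleSheaf L := (frameTopology L).yoneda.obj U

/-- A section of a sheaf over an open subspace, from a map out of the represented sheaf. -/
def openSheafHomEquiv {U : L} {F : LocaleSheaf L} :
    (openSheaf U ⟶ F) ≃ F.obj.obj (Opposite.op U) :=
  (fullyFaithfulSheafToPresheaf _ _).homEquiv.trans yonedaEquiv

instance (F : LocaleSheaf L) (U : L) : Subsingleton (F ⟶ openSheaf U) :=
  ⟨fun f g => by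
    apply Sheaf.hom_ext
    ext V x
    exact Subsingleton.elim (α := (V.unop ⟶ U)) _ _⟩

lemma LocaleSheaf.section_ext (F : LocaleSheaf L) {U : L} (T : Set L) (hT : U ≤ sSup T)
    (x y : F.obj.obj (Opposite.op U))
    (h : ∀ V ∈ T, ∀ i : V ⊓ U ⟶ U, F.obj.map i.op x = F.obj.map i.op y) : x = y := by
  have hF := (isSheaf_iff_isSheaf_of_type _ _).1 F.property
  let S : Sieve U :=
    { arrows := fun V _ => ∃ W ∈ T, V ≤ W
      downward_closed := fun ⟨W, hW, h⟩ g => ⟨W, hW, (leOfHom g).trans h⟩ }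
  have hS : S ∈ frameTopology L U := by
    refine le_antisymm (sSup_le fun _ ⟨f, _⟩ => leOfHom f) ?_
    calc U ≤ sSup T ⊓ U := le_inf hT le_rfl
      _ ≤ _ := by
        rw [sSup_inf_eq]
        exact iSup₂_le fun V hV => le_sSup ⟨homOfLE inf_le_right, V, hV, inf_le_left⟩
  refine (hF _ hS).isSeparatedFor.ext fun V f ⟨W, hW, hVW⟩ => ?_
  have hf : f = homOfLE (le_inf hVW (leOfHom f)) ≫ homOfLE inf_le_right := Subsingleton.elim _ _
  rw [hf, op_comp, F.obj.map_comp]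
  exact congrArg (F.obj.map (homOfLE (le_inf hVW (leOfHom f))).op) (h W hW _)

lemma LocaleSheaf.hom_ext_of_openSheaf {F G : LocaleSheaf L} (f g : F ⟶ G)
    (h : ∀ (U : L) (i : openSheaf U ⟶ F), i ≫ f = i ≫ g) : f = g := by
  apply Sheaf.hom_ext
  ext U x
  have key (k : F ⟶ G) : k.hom.app U x =
      openSheafHomEquiv (openSheafHomEquiv.symm x ≫ k) := by
    refine (congrArg (k.hom.app U) (openSheafHomEquiv.apply_symm_apply x).symm).trans ?_
    rfl
  exact (key f).trans ((congrArg _ (h _ _)).trans (key g).symm)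

lemma LocaleSheaf.hom_ext_of_cover {F : LocaleSheaf L} {U : L} (T : Set L) (hT : U ≤ sSup T)
    (f g : openSheaf U ⟶ F)
    (h : ∀ V ∈ T, ∀ i : openSheaf (V ⊓ U) ⟶ openSheaf U, i ≫ f = i ≫ g) : f = g := by
  apply openSheafHomEquiv.injective
  refine F.section_ext T hT _ _ fun V hV i => ?_
  have := congrArg openSheafHomEquiv (h V hV ((frameTopology L).yoneda.map i))
  have key : ∀ k : openSheaf U ⟶ F, F.obj.map i.op (openSheafHomEquiv k) =
      openSheafHomEquiv ((frameTopology L).yoneda.map i ≫ k) := fun k =>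
    yonedaEquiv_naturality k.hom i
  rw [key, key, this]

lemma LocaleSheaf.nonempty_hom_openSheaf {F : LocaleSheaf L} {U : L}
    (h : ∀ V : L, (openSheaf V ⟶ F) → V ≤ U) : Nonempty (F ⟶ openSheaf U) :=
  ⟨⟨{ app := fun V => ↾fun x => homOfLE (h V.unop (openSheafHomEquiv.symm x))
      naturality := fun V W f => by
        ext x
        exact Subsingleton.elim (α := (W.unop ⟶ U)) _ _ }⟩⟩

lemma LocaleSheaf.section_bot_subsingleton (F : LocaleSheaf L) :
    Subsingleton (F.obj.obj (Opposite.op ⊥)) :=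
  ⟨fun x y => F.section_ext ∅ bot_le x y (by simp)⟩

lemma LocaleSheaf.nonempty_section_bot (F : LocaleSheaf L) :
    Nonempty (F.obj.obj (Opposite.op ⊥)) := by
  have hF := (isSheaf_iff_isSheaf_of_type _ _).1 F.property
  have hS : (⊥ : Sieve (⊥ : L)) ∈ frameTopology L ⊥ :=
    le_antisymm (sSup_le fun _ ⟨f, _⟩ => leOfHom f) bot_le
  obtain ⟨x, -, -⟩ := hF _ hS (fun _ _ h => h.elim) (fun _ _ _ _ _ _ _ h => h.elim)
  exact ⟨x⟩

/-- Such an `F` has sections only over `⊥`, where every sheaf has exactly one because the empty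
sieve covers. -/
lemma LocaleSheaf.nonempty_isInitial {F : LocaleSheaf L} (p : F ⟶ openSheaf ⊥) :
    Nonempty (IsInitial F) := by
  have hbot : ∀ V : Lᵒᵖ, F.obj.obj V → V = Opposite.op ⊥ := fun V x =>
    congrArg Opposite.op (le_bot_iff.1 (leOfHom (p.hom.app V x)))
  have hsub (G : LocaleSheaf L) (V : Lᵒᵖ) (x : F.obj.obj V) : Subsingleton (G.obj.obj V) := by
    obtain rfl := hbot V x
    exact G.section_bot_subsingleton
  have hne (G : LocaleSheaf L) (V : Lᵒᵖ) (x : F.obj.obj V) : Nonempty (G.obj.obj V) := by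
    obtain rfl := hbot V x
    exact G.nonempty_section_bot
  refine ⟨IsInitial.ofUniqueHom (fun G => ⟨{
    app := fun V => ↾fun x => (hne G V x).some
    naturality := fun V W f => ?_ }⟩) fun G m => ?_⟩
  · ext x
    have := hsub G W (F.obj.map f x)
    exact Subsingleton.elim _ _
  · apply Sheaf.hom_ext
    ext V x
    have := hsub G V x
    exact Subsingleton.elim _ _

end opens

/-! ### Transport to an equivalent category; supports. -/

section localic

variable {L : Type u} [Order.Frame L] {E : Type v} [Category.{w} E] (e : E ≌ LocaleSheaf L)

/-- The inclusion of the open subspaces into a localic topos, as the subterminal objects. -/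
abbrev openFunctor : L ⥤ E := (frameTopology L).yoneda ⋙ e.inverse

instance (X : E) (U : L) : Subsingleton (X ⟶ (openFunctor e).obj U) :=
  (e.toAdjunction.homEquiv X (openSheaf U)).symm.subsingleton

lemma openFunctor_hom_iff {U V : L} :
    Nonempty ((openFunctor e).obj U ⟶ (openFunctor e).obj V) ↔ U ≤ V :=
  ⟨fun ⟨f⟩ => leOfHom ((openFunctor e).preimage f), fun h => ⟨(openFunctor e).map (homOfLE h)⟩⟩

lemma openFunctor_hom_ext {X : E} {U : L} (T : Set L) (hT : U ≤ sSup T)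
    (f g : (openFunctor e).obj U ⟶ X)
    (h : ∀ V ∈ T, ∀ i : (openFunctor e).obj (V ⊓ U) ⟶ (openFunctor e).obj U, i ≫ f = i ≫ g) :
    f = g := by
  apply (e.symm.toAdjunction.homEquiv (openSheaf U) X).injective
  refine LocaleSheaf.hom_ext_of_cover T hT _ _ fun V hV i => ?_
  have := h V hV (e.inverse.map i)
  rw [← Adjunction.homEquiv_naturality_left, ← Adjunction.homEquiv_naturality_left]
  exact congrArg _ this

lemma hom_ext_of_openFunctor {X Y : E} (f g : X ⟶ Y)
    (h : ∀ (U : L) (i : (openFunctor e).obj U ⟶ X), i ≫ f = i ≫ g) : f = g := by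
  apply e.functor.map_injective
  refine LocaleSheaf.hom_ext_of_openSheaf _ _ fun U i => ?_
  apply (e.symm.toAdjunction.homEquiv (openSheaf U) Y).symm.injective
  have key (k : X ⟶ Y) :=
    e.symm.toAdjunction.homEquiv_naturality_right_symm (X := openSheaf U) i k
  exact (key f).trans ((h U _).trans (key g).symm)

lemma nonempty_hom_openFunctor {X : E} {U : L}
    (h : ∀ V : L, ((openFunctor e).obj V ⟶ X) → V ≤ U) :
    Nonempty (X ⟶ (openFunctor e).obj U) := by
  obtain ⟨p⟩ := LocaleSheaf.nonempty_hom_openSheaf (F := e.functor.obj X) (U := U) fun V f =>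
    h V ((e.symm.toAdjunction.homEquiv (openSheaf V) X).symm f)
  exact ⟨e.toAdjunction.homEquiv X (openSheaf U) p⟩

lemma nonempty_isInitial_of_hom {X : E} (p : X ⟶ (openFunctor e).obj ⊥) :
    Nonempty (IsInitial X) := by
  obtain ⟨h⟩ := LocaleSheaf.nonempty_isInitial
    ((e.toAdjunction.homEquiv X (openSheaf (⊥ : L))).symm p)
  exact ⟨IsInitial.isInitialOfObj e.functor X h⟩

lemma nonempty_isTerminal_openFunctor_top :
    Nonempty (IsTerminal ((openFunctor e).obj ⊤)) :=
  ⟨IsTerminal.ofUniqueHom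
    (fun _ => (nonempty_hom_openFunctor e fun _ _ => le_top).some)
    fun _ _ => Subsingleton.elim _ _⟩

/-- Maps into a subterminal object from a subterminal one are monic, and sheaf categories are
balanced. -/
lemma le_of_epi_openFunctor {U V : L} (p : (openFunctor e).obj U ⟶ (openFunctor e).obj V)
    [Epi p] : V ≤ U := by
  let q : openSheaf U ⟶ openSheaf V := e.inverse.preimage p
  have : Epi (e.inverse.map q) := by rwa [e.inverse.map_preimage]
  have : Epi q := e.inverse.epi_of_epi_map this
  have : Mono q := ⟨fun _ _ _ => Subsingleton.elim _ _⟩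
  have := isIso_of_mono_of_epi q
  exact leOfHom ((frameTopology L).yoneda.preimage (inv q))

/-- The support of an object of a localic topos. -/
def openSupport (X : E) : L := sSup {V : L | Nonempty ((openFunctor e).obj V ⟶ X)}

lemma nonempty_hom_openSupport (X : E) : Nonempty (X ⟶ (openFunctor e).obj (openSupport e X)) :=
  nonempty_hom_openFunctor e fun _ f => le_sSup ⟨f⟩

lemma openSupport_le {X : E} {U : L} (f : X ⟶ (openFunctor e).obj U) : openSupport e X ≤ U :=
  sSup_le fun _ ⟨g⟩ => (openFunctor_hom_iff e).1 ⟨g ≫ f⟩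

/-! ### Cardinal finiteness and complements. -/

section

lemma openSupport_prod_le [HasFiniteProducts E] {X Y : E} {U : L}
    (f : X ⨯ Y ⟶ (openFunctor e).obj U) :
    openSupport e X ⊓ openSupport e Y ≤ U := by
  rw [openSupport, openSupport, sSup_inf_sSup]
  refine iSup₂_le fun ⟨V, W⟩ h => ?_
  obtain ⟨⟨a⟩, ⟨b⟩⟩ := h
  exact (openFunctor_hom_iff e).1 ⟨prod.lift ((openFunctor e).map (homOfLE inf_le_left) ≫ a)
    ((openFunctor e).map (homOfLE inf_le_right) ≫ b) ≫ f⟩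

lemma nonempty_iso_over_of_hom {Z : E} (A B : Over Z)
    (a : A.left ⟶ (openFunctor e).obj ⊥) (b : B.left ⟶ (openFunctor e).obj ⊥) :
    Nonempty (A ≅ B) := by
  obtain ⟨ha⟩ := nonempty_isInitial_of_hom e a
  obtain ⟨hb⟩ := nonempty_isInitial_of_hom e b
  exact ⟨Over.isoMk (ha.uniqueUpToIso hb) (ha.hom_ext _ _)⟩

variable [HasFiniteProducts E] [HasFiniteCoproducts E]

lemma IsCardinalFinite.isComplemented_openSupport {X : E} (hX : IsCardinalFinite X) :
    IsComplemented (openSupport e X) := by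
  obtain ⟨V, hV, hiso⟩ := hX
  have hcover (n : ℕ) :
      Nonempty (V n ⟶ (openFunctor e).obj (openSupport e X ⊔ openSupport e (V 0))) := by
    obtain - | n := n
    · obtain ⟨p⟩ := nonempty_hom_openSupport e (V 0)
      exact ⟨p ≫ (openFunctor e).map (homOfLE le_sup_right)⟩
    · obtain ⟨φ⟩ := hiso (n + 1)
      obtain ⟨p⟩ := nonempty_hom_openSupport e X
      -- With at least one copy of the terminal object, a coproduct injection gives a map to the
      -- pullback of `X`.
      let s : V (n + 1) ⟶ V (n + 1) ⨯ X :=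
        (Sigma.ι (fun _ : Fin (n + 1) => Over.mk (𝟙 (V (n + 1)))) 0 ≫ φ.inv).left
      exact ⟨s ≫ prod.snd ≫ p ≫ (openFunctor e).map (homOfLE le_sup_left)⟩
  refine ⟨openSupport e (V 0), disjoint_iff_inf_le.2 ?_, codisjoint_iff_le_sup.2 ?_⟩
  · obtain ⟨φ⟩ := hiso 0
    have h₀ : IsInitial (∐ fun _ : Fin 0 => Over.mk (𝟙 (V 0))) :=
      (isColimitEquivIsInitialOfIsEmpty _ _) (colimit.isColimit _)
    have h₁ : IsInitial ((Over.forget (V 0)).obj (∐ fun _ : Fin 0 => Over.mk (𝟙 (V 0)))) :=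
      IsInitial.isInitialObj _ _ h₀
    rw [inf_comm]
    exact openSupport_prod_le e (φ.hom.left ≫ h₁.to _)
  · obtain ⟨ht⟩ := nonempty_isTerminal_openFunctor_top (L := L) e
    let p := (openFunctor e).map (homOfLE (le_top (a := openSupport e X ⊔ openSupport e (V 0))))
    have : Epi p := ⟨fun {Y} f g hfg => by
      have key : ht.from (⊤_ E) ≫ f = ht.from (⊤_ E) ≫ g := hV _ _ fun n => by
        obtain ⟨q⟩ := hcover n
        have hq : terminal.from (V n) ≫ ht.from (⊤_ E) = q ≫ p := ht.hom_ext _ _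
        rw [reassoc_of% hq, reassoc_of% hq, hfg]
      have hid : terminal.from _ ≫ ht.from (⊤_ E) = 𝟙 _ := ht.hom_ext _ _
      rw [← Category.id_comp f, ← Category.id_comp g, ← hid, Category.assoc, key, Category.assoc]⟩
    exact le_of_epi_openFunctor e p

lemma isCardinalFinite_openFunctor {b : L} (hb : IsComplemented b) :
    IsCardinalFinite ((openFunctor e).obj b) := by
  obtain ⟨c, hbc⟩ := hb
  -- Cardinality 0 holds over the complement `c`, 1 over `b`, and larger values only over `⊥`.
  refine ⟨fun n => (openFunctor e).obj (if n = 0 then c else if n = 1 then b else ⊥),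
    fun Y f g h => ?_, fun n => ?_⟩
  · obtain ⟨ht⟩ := nonempty_isTerminal_openFunctor_top (L := L) e
    have key : terminal.from ((openFunctor e).obj ⊤) ≫ f = terminal.from _ ≫ g := by
      refine openFunctor_hom_ext e {b, c} (by simp [hbc.sup_eq_top]) _ _ fun V hV i => ?_
      have aux (n : ℕ) (hn : V = if n = 0 then c else if n = 1 then b else ⊥) :
          i ≫ terminal.from _ ≫ f = i ≫ terminal.from _ ≫ g := by
        subst hn
        have hi : i ≫ terminal.from _ =
            (openFunctor e).map (homOfLE inf_le_left) ≫ terminal.from _ := terminal.hom_ext _ _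
        rw [← Category.assoc, ← Category.assoc, hi, Category.assoc, Category.assoc]
        exact congrArg _ (h n)
      obtain rfl | rfl := hV
      · exact aux 1 (by simp)
      · exact aux 0 (by simp)
    have hid : ht.from (⊤_ E) ≫ terminal.from _ = 𝟙 _ := Subsingleton.elim _ _
    rw [← Category.id_comp f, ← Category.id_comp g, ← hid, Category.assoc, key, Category.assoc]
  · obtain - | - | n := n
    · have h₀ : IsInitial (∐ fun _ : Fin 0 => Over.mk (𝟙 ((openFunctor e).obj
          (if 0 = 0 then c else if 0 = 1 then b else ⊥)))) :=
        (isColimitEquivIsInitialOfIsEmpty _ _) (colimit.isColimit _)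
      have h₁ := IsInitial.isInitialObj (Over.forget _) _ h₀
      refine nonempty_iso_over_of_hom e _ _ ?_ (h₁.to _)
      refine (nonempty_hom_openFunctor e fun V f => ?_).some
      have hc : V ≤ c := (openFunctor_hom_iff e).1 ⟨f ≫ prod.fst⟩
      have hb : V ≤ b := (openFunctor_hom_iff e).1 ⟨f ≫ prod.snd⟩
      exact hbc.disjoint hb hc
    · have hid : prod.fst ≫ prod.lift (𝟙 _) (𝟙 _) =
          𝟙 ((openFunctor e).obj b ⨯ (openFunctor e).obj b) := by
        apply prod.hom_ext <;> exact Subsingleton.elim _ _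
      let φ : (Over.star ((openFunctor e).obj b)).obj ((openFunctor e).obj b) ≅
          Over.mk (𝟙 ((openFunctor e).obj b)) :=
        Over.isoMk ⟨prod.fst, prod.lift (𝟙 _) (𝟙 _), hid, prod.lift_fst _ _⟩
          (Subsingleton.elim (α := (_ ⟶ (openFunctor e).obj b)) _ _)
      exact ⟨φ ≪≫ (coproductUniqueIso
        fun _ : Fin 1 => Over.mk (𝟙 ((openFunctor e).obj b))).symm⟩
    -- Over `⊥` every object is initial.
    · exact nonempty_iso_over_of_hom e _ _ (Over.hom _) (Over.hom _)

end

/-! ### Bases and generating families. -/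

lemma isSeparating_openFunctor {B : Set L} (hB : IsLocaleBasis B) :
    (ObjectProperty.ofObj fun b : B => (openFunctor e).obj b).IsSeparating := by
  intro X Y f g h
  refine hom_ext_of_openFunctor e f g fun U i => ?_
  obtain ⟨S, hS, rfl⟩ := hB U
  refine openFunctor_hom_ext e S le_rfl _ _ fun V hV j => ?_
  rw [← Category.assoc, ← Category.assoc]
  generalize j ≫ i = k
  generalize hW : V ⊓ sSup S = W at k
  rw [inf_eq_left.2 (le_sSup hV)] at hW
  subst hW
  exact h _ (ObjectProperty.ofObj_apply _ (⟨V, hS hV⟩ : B)) k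

end localic

lemma eq_sSup_isComplemented {L : Type u} [Order.Frame L] {E : Type v} [Category.{w} E]
    [HasFiniteProducts E] [HasFiniteCoproducts E] (e : E ≌ LocaleSheaf L)
    {I : Type*} (D : I → E) (hD : ∀ i, IsCardinalFinite (D i))
    (hsep : (ObjectProperty.ofObj D).IsSeparating) (U : L) :
    U = sSup {V : L | IsComplemented V ∧ V ≤ U} := by
  refine le_antisymm ?_ (sSup_le fun _ h => h.2)
  let p := (openFunctor e).map (homOfLE (sSup_le fun _ h => h.2 :
    sSup {V : L | IsComplemented V ∧ V ≤ U} ≤ U))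
  have : Epi p := ⟨fun {Y} f g hfg => hsep f g fun G hG h => by
    obtain ⟨i⟩ := hG
    obtain ⟨q⟩ := nonempty_hom_openSupport e (D i)
    have hle : openSupport e (D i) ≤ sSup {V : L | IsComplemented V ∧ V ≤ U} :=
      le_sSup ⟨(hD i).isComplemented_openSupport e, openSupport_le e h⟩
    -- As `U` is subterminal, `h` is the map through the support, so it factors through `p`.
    rw [Subsingleton.elim h (q ≫ (openFunctor e).map (homOfLE hle) ≫ p)]
    simp only [Category.assoc, hfg]⟩
  exact le_of_epi_openFunctor e p

theorem mainTheorem10 (L : Type u) [Order.Frame L]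
    (E : Type v) [Category.{w} E] [HasFiniteProducts E] [HasFiniteCoproducts E]
    (e : E ≌ LocaleSheaf L) :
    IsGeneratedByCardinalFinite.{u} E ↔
      ∃ B : Set L, (∀ b ∈ B, IsComplemented b) ∧ IsLocaleBasis B := by
  constructor
  · rintro ⟨I, D, hD, hsep⟩
    exact ⟨{V | IsComplemented V}, fun _ h => h, fun U =>
      ⟨{V | IsComplemented V ∧ V ≤ U}, fun _ h => h.1, eq_sSup_isComplemented e D hD hsep U⟩⟩
  · rintro ⟨B, hB, hbasis⟩
    exact ⟨B, fun b => (openFunctor e).obj b,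
      fun b => isCardinalFinite_openFunctor e (hB b b.2), isSeparating_openFunctor e hbasis⟩
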